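/- Let $\mathbb D=\{z\in\mathbb C:|z|<1\}$, let $\mathbb T=\partial\mathbb D$, and let $m$ be normalized arc length measure on $\mathbb T$; write $L^p=L^p(\mathbb T,m)$ and let $\|\cdot\|_\infty$ be the essential supremum norm. For $f\in L^1$ let $$\mathcal Pf(z)=\int_{\mathbb T}\frac{1-|z|^2}{|\zeta-z|^2}\,f(\zeta)\,dm(\zeta),\qquad z\in\mathbb D,$$ be its Poisson integral. For $f\in L^2$ put $\Phi_f(z)=\mathcal P(|f|^2)(z)-|\mathcal Pf(z)|^2$ and let $\|f\|_G=\sup_{z\in\mathbb D}\Phi_f(z)^{1/2}$ be the Garsia norm of $f$. A function $f\in L^\infty$ is called $G$-extremal if $\|f\|_G=\|f\|_\infty$. Let $H^\infty$ be the set of all $f\in L^\infty$ for which $\mathcal Pf$ is analytic on $\mathbb D$; for such $f$ we write $f(z)=\mathcal Pf(z)$ when $z\in\mathbb D$. A function $I\in H^\infty$ is inner if $|I|=1$ a.e. on $\mathbb T$. An analytic function $F$ on $\mathbb D$ is outer if it is zero-free and $\log|F|$ is the Poisson integral of a (real-valued) $L^1$ function on $\mathbb T$. Let $\mathcal A=H^\infty\cap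 C(\mathbb T)$ be the disk algebra; a function $F\in\mathcal A$ is regarded as a function on $\mathbb D\cup\mathbb T$, being given by its Poisson integral in $\mathbb D$. For $F\in\mathcal A$ and $I$ inner, put $$\mathcal M(F)=\{z\in\mathbb D\cup\mathbb T:\ |F(z)|=\|F\|_\infty\},\qquad \sigma(I)=\Bigl\{z\in\mathbb D\cup\mathbb T:\ \liminf_{\mathbb D\ni w\to z}|I(w)|=0\Bigr\}.$$ **Corollary.** Let $F\in\mathcal A$ be an outer function and let $I$ be an inner function. Then the product $IF$ is $G$-extremal if and only if $\mathcal M(F)\cap\sigma(I)\neq\emptyset$. -/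

import Mathlib

open MeasureTheory Metric Set Filter
open scoped Topology ENNReal

noncomputable section

namespace GarsiaExtremal

/-- The Borel `σ`-algebra on the unit circle `𝕋`. -/
instance circleMeasurableSpace : MeasurableSpace Circle := borel Circle

instance circleBorelSpace : BorelSpace Circle := ⟨rfl⟩

/-- The open unit disk `𝔻`. -/
def disk : Set ℂ := ball 0 1

/-- Normalized arc length measure `m` on the unit circle: the image of `dθ / 2π` on `(0, 2π]`
under `θ ↦ exp (iθ)`. -/
def arc : Measure Circle :=
  (ENNReal.ofReal (2 * Real.pi))⁻¹ •
    (volume.restrict (Ioc (0 : ℝ) (2 * Real.pi))).map Circle.exp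

/-- The Poisson integral
`𝒫f(z) = ∫_𝕋 (1 - |z|²) / |ζ - z|² f(ζ) dm(ζ)`, `z ∈ 𝔻`, of a real or complex function `f ∈ L¹`. -/
def poisson {E : Type*} [NormedAddCommGroup E] [NormedSpace ℝ E] (f : Circle → E) (z : ℂ) : E :=
  ∫ ζ : Circle, ((1 - ‖z‖ ^ 2) / ‖(ζ : ℂ) - z‖ ^ 2) • f ζ ∂arc

/-- `Φ_f(z) = 𝒫(|f|²)(z) - |𝒫f(z)|²`. -/
def Phi (f : Circle → ℂ) (z : ℂ) : ℝ :=
  poisson (fun ζ => ‖f ζ‖ ^ 2) z - ‖poisson f z‖ ^ 2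

/-- The Garsia norm `‖f‖_G = sup {Φ_f(z)^{1/2} : z ∈ 𝔻}`, with values in `[0, ∞]`. -/
def garsiaNorm (f : Circle → ℂ) : ℝ≥0∞ :=
  ⨆ z ∈ disk, ENNReal.ofReal (Real.sqrt (Phi f z))

/-- `f ∈ L^∞` is `G`-extremal if `‖f‖_G = ‖f‖_∞`. -/
def IsGExtremal (f : Circle → ℂ) : Prop :=
  MemLp f ∞ arc ∧ garsiaNorm f = eLpNorm f ∞ arc

/-- `f ∈ H^∞`: `f ∈ L^∞` and its Poisson integral is analytic on `𝔻`. -/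
def MemHInfty (f : Circle → ℂ) : Prop :=
  MemLp f ∞ arc ∧ AnalyticOnNhd ℂ (poisson f) disk

/-- An inner function: a unimodular function in `H^∞`. -/
def IsInner (f : Circle → ℂ) : Prop :=
  MemHInfty f ∧ ∀ᵐ ζ ∂arc, ‖f ζ‖ = 1

/-- An outer function on `𝔻`: analytic, zero-free, and such that `log |F|` is the Poisson
integral of an `L¹` function on the circle. -/
def IsOuter (F : ℂ → ℂ) : Prop :=
  AnalyticOnNhd ℂ F disk ∧ (∀ z ∈ disk, F z ≠ 0) ∧
    ∃ u : Circle → ℝ, Integrable u arc ∧ ∀ z ∈ disk, Real.log ‖F z‖ = poisson u z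

/-- The disk algebra `𝒜 = H^∞ ∩ C(𝕋)`. -/
def MemDiskAlgebra (F : Circle → ℂ) : Prop :=
  MemHInfty F ∧ Continuous F

open Classical in
/-- A function `F` on the circle viewed as a function on the closed disk `𝔻 ∪ 𝕋`: it is `F` itself
on the circle and the Poisson integral of `F` inside. -/
def closedDiskFun (F : Circle → ℂ) (z : ℂ) : ℂ :=
  if h : ‖z‖ = 1 then F ⟨z, mem_sphere_zero_iff_norm.2 h⟩ else poisson F z

/-- `ℳ(F)`, the set of points of the closed disk where `|F|` equals `‖F‖_∞`. -/
def maxModulusSet (F : Circle → ℂ) : Set ℂ :=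
  {z ∈ closedBall (0 : ℂ) 1 | ‖closedDiskFun F z‖ₑ = eLpNorm F ∞ arc}

/-- The spectrum `σ(I)`: the points `z` of the closed disk with
`liminf |I(w)| = 0` as `w → z`, `w ∈ 𝔻`. -/
def innerSpectrum (I : Circle → ℂ) : Set ℂ :=
  {z ∈ closedBall (0 : ℂ) 1 | liminf (fun w => ‖poisson I w‖ₑ) (𝓝[disk] z) = 0}

end GarsiaExtremal

end

noncomputable section

namespace GarsiaExtremal

/-! ### Arc length measure -/

/-! Let `M = ‖F‖_∞`. Because `|I| = 1` a.e. and the Poisson integral is multiplicative here, `Φ_{IF}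
= 𝒫(|F|²) - |I|²|F|² ≤ M²` in the disk (`Phi_mul_inner`). Hence `IF` is extremal exactly when, along
points of the disk, `𝒫(|F|²)` approaches `M²` while `IF` approaches `0`. By compactness such points
cluster at some `z` in the closed disk. The function `𝒫(|F|²)` extends continuously to the closed
disk, and its value at `z` is `M²` iff `|F(z)| = M` (`tendsto_poisson_norm_sq_iff`). On the circle
this is immediate; inside, either equality forces `|F| = M` on the whole circle, and zero-freeness
of the outer function carries this into the disk through the maximum principle for `1/F`. Near `z`
the modulus of `F` then tends to `M > 0`, so smallness of `IF` means smallness of `I`, which is `z ∈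
σ(I)`. Multiplicativity (`poisson_mul`) is derived from analyticity of the Poisson integral: the
antianalytic Herglotz part is constant, so multiplication by `ζ` becomes multiplication by `z`; this
passes to powers, power series, dilations `F(rζ)`, and finally to `r → 1`. -/

lemma measurable_circleExp : Measurable Circle.exp := Circle.exp.continuous.measurable

instance isProbabilityMeasure_arc : IsProbabilityMeasure arc := by
  constructor
  have h : ENNReal.ofReal (2 * Real.pi) ≠ 0 := by
    simpa using Real.pi_pos
  simp only [arc, Measure.smul_apply, smul_eq_mul]
  rw [Measure.map_apply measurable_circleExp MeasurableSet.univ]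
  simp only [preimage_univ, Measure.restrict_apply MeasurableSet.univ, univ_inter, Real.volume_Ioc,
    sub_zero]
  exact ENNReal.inv_mul_cancel h ENNReal.ofReal_ne_top

/-- Upgrades a.e. statements about continuous functions to statements at every point of the circle.
-/
instance isOpenPosMeasure_arc : arc.IsOpenPosMeasure := by
  constructor
  intro U hU hne
  simp only [arc, Measure.smul_apply, smul_eq_mul]
  rw [Measure.map_apply measurable_circleExp hU.measurableSet]
  have hV : IsOpen (Circle.exp ⁻¹' U) := hU.preimage Circle.exp.continuous
  refine mul_ne_zero (ENNReal.inv_ne_zero.2 ENNReal.ofReal_ne_top) ?_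
  obtain ⟨x, hx⟩ := hne
  obtain ⟨t, ht, rfl⟩ : ∃ t ∈ Ioc (0 : ℝ) (2 * Real.pi), Circle.exp t = x := by
    obtain ⟨s, rfl⟩ := Circle.exp_surjective x
    obtain ⟨t, ht, h⟩ := Circle.periodic_exp.exists_mem_Ioc Real.two_pi_pos s 0
    exact ⟨t, by simpa using ht, h.symm⟩
  -- The parameter may be the endpoint `2π`, so it is replaced by a nearby interior point.
  have hcl : t ∈ closure (Ioo (0 : ℝ) (2 * Real.pi)) := by
    rw [closure_Ioo Real.two_pi_pos.ne]
    exact ⟨ht.1.le, ht.2⟩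
  obtain ⟨y, hy, hy'⟩ := mem_closure_iff.1 hcl _ hV hx
  have hpos := (hV.inter isOpen_Ioo).measure_pos volume ⟨y, hy, hy'⟩
  rw [Measure.restrict_apply hV.measurableSet]
  refine (hpos.trans_le (measure_mono ?_)).ne'
  exact inter_subset_inter_right _ Ioo_subset_Ioc_self

variable {E : Type*} [NormedAddCommGroup E]

open Classical in
/-- Extension by zero of a function on the circle to the plane. -/
def extendZero (f : Circle → E) (z : ℂ) : E :=
  if h : ‖z‖ = 1 then f ⟨z, mem_sphere_zero_iff_norm.2 h⟩ else 0

lemma extendZero_circleMap (f : Circle → E) (t : ℝ) :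
    extendZero f (circleMap 0 1 t) = f (Circle.exp t) := by
  have h : ‖circleMap 0 1 t‖ = 1 := by simp
  rw [extendZero, dif_pos h]
  congr 1
  ext
  simp [circleMap]

lemma integrable_of_continuous {g : Circle → E} (hg : Continuous g) : Integrable g arc :=
  hg.integrable_of_hasCompactSupport (HasCompactSupport.of_compactSpace g)

lemma circleIntegrable_extendZero {f : Circle → E} (hf : Integrable f arc) :
    CircleIntegrable (extendZero f) 0 1 := by
  rw [CircleIntegrable, intervalIntegrable_iff, uIoc_of_le Real.two_pi_pos.le]
  simp only [extendZero_circleMap]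
  rw [arc] at hf
  have h := hf.of_measure_le_smul (μ' := (volume.restrict (Ioc (0 : ℝ) (2 * Real.pi))).map
    Circle.exp) (c := ENNReal.ofReal (2 * Real.pi)) ENNReal.ofReal_ne_top (by
      rw [smul_smul, ENNReal.mul_inv_cancel (by simpa using Real.pi_pos) ENNReal.ofReal_ne_top,
        one_smul])
  exact h.comp_measurable measurable_circleExp

variable [NormedSpace ℝ E]

/-- Bridge to circle averages, for which the Poisson and Herglotz formulas are available. -/
lemma integral_arc {f : Circle → E} (hf : AEStronglyMeasurable f arc) :
    ∫ ζ, f ζ ∂arc = Real.circleAverage (extendZero f) 0 1 := by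
  have h : ENNReal.ofReal (2 * Real.pi) ≠ 0 := by
    simpa using Real.pi_pos
  have hf' : AEStronglyMeasurable f
      ((volume.restrict (Ioc (0 : ℝ) (2 * Real.pi))).map Circle.exp) := by
    refine hf.mono_ac ?_
    rw [arc]
    exact Measure.absolutelyContinuous_smul (ENNReal.inv_ne_zero.2 ENNReal.ofReal_ne_top)
  rw [arc, integral_smul_measure, integral_map measurable_circleExp.aemeasurable hf',
    Real.circleAverage, intervalIntegral.integral_of_le Real.two_pi_pos.le]
  simp only [extendZero_circleMap]
  rw [ENNReal.toReal_inv, ENNReal.toReal_ofReal Real.two_pi_pos.le]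

/-! ### The Poisson kernel -/

lemma norm_coe_sub_pos {z : ℂ} (hz : z ∈ disk) (ζ : Circle) : 0 < ‖(ζ : ℂ) - z‖ := by
  rw [norm_pos_iff, sub_ne_zero]
  rintro rfl
  exact absurd (mem_ball_zero_iff.1 hz) (by rw [Circle.norm_coe]; exact lt_irrefl 1)

lemma one_sub_norm_sq_pos {z : ℂ} (hz : z ∈ disk) : 0 < 1 - ‖z‖ ^ 2 := by
  have : ‖z‖ < 1 := by simpa [disk] using hz
  nlinarith [norm_nonneg z]

/-- The Poisson kernel of the unit disk. -/
def kernel (z : ℂ) (ζ : Circle) : ℝ := (1 - ‖z‖ ^ 2) / ‖(ζ : ℂ) - z‖ ^ 2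

lemma poisson_eq (f : Circle → E) (z : ℂ) : poisson f z = ∫ ζ, kernel z ζ • f ζ ∂arc := rfl

lemma kernel_pos {z : ℂ} (hz : z ∈ disk) (ζ : Circle) : 0 < kernel z ζ :=
  div_pos (one_sub_norm_sq_pos hz) (pow_pos (norm_coe_sub_pos hz ζ) 2)

lemma continuous_kernel {z : ℂ} (hz : z ∈ disk) : Continuous (kernel z) := by
  refine continuous_const.div (by fun_prop) fun ζ => ?_
  exact (pow_pos (norm_coe_sub_pos hz ζ) 2).ne'

lemma kernel_le {z : ℂ} (hz : z ∈ disk) (ζ : Circle) {d : ℝ} (hd : 0 < d)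
    (h : d ≤ ‖(ζ : ℂ) - z‖) : kernel z ζ ≤ (1 - ‖z‖ ^ 2) / d ^ 2 :=
  div_le_div_of_nonneg_left (one_sub_norm_sq_pos hz).le (by positivity) (by gcongr)

lemma kernel_le_of_norm_le {z : ℂ} {r : ℝ} (hr : r < 1) (hz : ‖z‖ ≤ r) (ζ : Circle) :
    kernel z ζ ≤ 1 / (1 - r) ^ 2 := by
  have hz' : z ∈ disk := by simpa [disk] using hz.trans_lt hr
  have h1 : 1 - r ≤ ‖(ζ : ℂ) - z‖ := by
    have := norm_sub_norm_le (ζ : ℂ) z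
    rw [Circle.norm_coe] at this
    linarith
  refine (kernel_le hz' ζ (by linarith) h1).trans ?_
  gcongr
  nlinarith [norm_nonneg z]

lemma integrable_kernel_smul {f : Circle → E} (hf : Integrable f arc) {z : ℂ} (hz : z ∈ disk) :
    Integrable (fun ζ => kernel z ζ • f ζ) arc := by
  refine hf.bdd_smul (1 / (1 - ‖z‖) ^ 2) (continuous_kernel hz).aestronglyMeasurable ?_
  refine ae_of_all _ fun ζ => ?_
  rw [Real.norm_of_nonneg (kernel_pos hz ζ).le]
  exact kernel_le_of_norm_le (by simpa [disk] using hz) le_rfl ζ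

lemma integral_kernel {z : ℂ} (hz : z ∈ disk) : ∫ ζ, kernel z ζ ∂arc = 1 := by
  rw [integral_arc (continuous_kernel hz).aestronglyMeasurable]
  have h1 : DiffContOnCl ℂ (fun _ : ℂ => (1 : ℂ)) (ball 0 1) := diffContOnCl_const
  have h2 := h1.circleAverage_poissonKernel_smul (w := z) hz
  have h3 : ((Real.circleAverage (extendZero (kernel z)) 0 1 : ℝ) : ℂ) = 1 := by
    rw [← h2, Real.circleAverage, Real.circleAverage, Complex.real_smul, smul_eq_mul,
      Complex.ofReal_mul]
    congr 1
    rw [← intervalIntegral.integral_ofReal]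
    congr 1
    ext t
    rw [extendZero_circleMap]
    simp [kernel, poissonKernel, circleMap, Circle.coe_exp]
  exact_mod_cast h3

lemma poisson_const [CompleteSpace E] (c : E) {z : ℂ} (hz : z ∈ disk) :
    poisson (fun _ => c) z = c := by
  rw [poisson_eq, integral_smul_const, integral_kernel hz, one_smul]

lemma poisson_sub {f g : Circle → E} (hf : Integrable f arc) (hg : Integrable g arc) {z : ℂ}
    (hz : z ∈ disk) : poisson (fun ζ => f ζ - g ζ) z = poisson f z - poisson g z := by
  simp only [poisson_eq, smul_sub]
  exact integral_sub (integrable_kernel_smul hf hz) (integrable_kernel_smul hg hz)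

lemma poisson_le_of_le {g : Circle → ℝ} (hg : Integrable g arc) {M : ℝ} (h : ∀ ζ, g ζ ≤ M) {z : ℂ}
    (hz : z ∈ disk) : poisson g z ≤ M := by
  rw [← poisson_const M hz, poisson_eq, poisson_eq]
  refine integral_mono (integrable_kernel_smul hg hz)
    (integrable_kernel_smul (integrable_const M) hz) fun ζ => ?_
  exact mul_le_mul_of_nonneg_left (h ζ) (kernel_pos hz ζ).le

lemma norm_poisson_le (f : Circle → E) {z : ℂ} (hz : z ∈ disk) :
    ‖poisson f z‖ ≤ poisson (fun ζ => ‖f ζ‖) z := by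
  rw [poisson_eq, poisson_eq]
  refine (norm_integral_le_integral_norm _).trans_eq ?_
  congr 1
  ext ζ
  rw [norm_smul, Real.norm_of_nonneg (kernel_pos hz ζ).le, smul_eq_mul]

/-- A continuous function whose Poisson integral attains an upper bound `M` of the function at a
point of the disk is constantly `M`. -/
lemma eq_of_poisson_ge {g : Circle → ℝ} (hg : Continuous g) {M : ℝ} (h : ∀ ζ, g ζ ≤ M) {z : ℂ}
    (hz : z ∈ disk) (hM : M ≤ poisson g z) (ζ : Circle) : g ζ = M := by
  have hc : Continuous fun ζ => kernel z ζ • (M - g ζ) :=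
    (continuous_kernel hz).smul (continuous_const.sub hg)
  have h0 : ∫ ζ, kernel z ζ • (M - g ζ) ∂arc = 0 := by
    have h1 := poisson_sub (integrable_const M) (integrable_of_continuous hg) hz
    rw [poisson_const M hz, poisson_eq] at h1
    rw [h1]
    linarith [poisson_le_of_le (integrable_of_continuous hg) h hz]
  have hn : ∀ ζ, 0 ≤ kernel z ζ • (M - g ζ) := fun ζ =>
    mul_nonneg (kernel_pos hz ζ).le (sub_nonneg.2 (h ζ))
  have h2 := (integral_eq_zero_iff_of_nonneg hn (integrable_of_continuous hc)).1 h0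
  have h3 := congrFun ((hc.ae_eq_iff_eq arc continuous_const).1 h2) ζ
  have h4 : M - g ζ = 0 := (smul_eq_zero.1 h3).resolve_left (kernel_pos hz ζ).ne'
  linarith

/-! ### Continuity and boundary values of Poisson integrals -/

lemma continuousOn_poisson {f : Circle → E} (hf : Integrable f arc) :
    ContinuousOn (poisson f) disk := by
  intro z hz
  refine ContinuousAt.continuousWithinAt ?_
  have hz1 : ‖z‖ < 1 := by simpa [disk] using hz
  obtain ⟨r, hzr, hr⟩ := exists_between hz1
  have hev : ∀ᶠ w in 𝓝 z, ‖w‖ < r := continuous_norm.continuousAt.eventually_lt_const hzr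
  have hin : ∀ w : ℂ, ‖w‖ < r → w ∈ disk := fun w hw => by simpa [disk] using hw.trans hr
  refine continuousAt_of_dominated (F := fun w ζ => kernel w ζ • f ζ)
    (bound := fun ζ => 1 / (1 - r) ^ 2 * ‖f ζ‖) ?_ ?_ (hf.norm.const_mul _) ?_
  · filter_upwards [hev] with w hw
    exact (integrable_kernel_smul hf (hin w hw)).aestronglyMeasurable
  · filter_upwards [hev] with w hw
    refine ae_of_all _ fun ζ => ?_
    rw [norm_smul, Real.norm_of_nonneg (kernel_pos (hin w hw) ζ).le]
    exact mul_le_mul_of_nonneg_right (kernel_le_of_norm_le hr hw.le ζ) (norm_nonneg _)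
  · refine ae_of_all _ fun ζ => ContinuousAt.smul ?_ continuousAt_const
    refine ContinuousAt.div (by fun_prop) (by fun_prop) ?_
    exact (pow_pos (norm_coe_sub_pos hz ζ) 2).ne'

/-- The Poisson integral of a continuous function has that function as its boundary values. -/
lemma tendsto_poisson_boundary [CompleteSpace E] {g : Circle → E} (hg : Continuous g) (ζ₀ : Circle) :
    Tendsto (poisson g) (𝓝[disk] (ζ₀ : ℂ)) (𝓝 (g ζ₀)) := by
  obtain ⟨B, hB⟩ : ∃ B : ℝ, ∀ ζ, ‖g ζ - g ζ₀‖ ≤ B := by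
    obtain ⟨B, hB⟩ := isCompact_univ.exists_bound_of_continuousOn
      (f := fun ζ => g ζ - g ζ₀) (by fun_prop)
    exact ⟨B, fun ζ => hB ζ trivial⟩
  have hB0 : 0 ≤ B := (norm_nonneg _).trans (hB ζ₀)
  rw [Metric.tendsto_nhds]
  intro ε hε
  obtain ⟨δ, hδ, hδg⟩ := Metric.continuous_iff.1 hg ζ₀ (ε / 2) (by positivity)
  have hlim : Tendsto (fun z : ℂ => ε / 2 + (1 - ‖z‖ ^ 2) / (δ / 2) ^ 2 * B) (𝓝[disk] (ζ₀ : ℂ))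
      (𝓝 (ε / 2)) := by
    have : Continuous fun z : ℂ => ε / 2 + (1 - ‖z‖ ^ 2) / (δ / 2) ^ 2 * B := by fun_prop
    have h := this.tendsto (ζ₀ : ℂ)
    simp only [Circle.norm_coe, one_pow, sub_self, zero_div, zero_mul, add_zero] at h
    exact h.mono_left nhdsWithin_le_nhds
  have hclose : ∀ᶠ z : ℂ in 𝓝[disk] (ζ₀ : ℂ), dist z ζ₀ < δ / 2 :=
    mem_nhdsWithin_of_mem_nhds (ball_mem_nhds (ζ₀ : ℂ) (half_pos hδ))
  filter_upwards [hlim.eventually_lt_const (half_lt_self hε), hclose, self_mem_nhdsWithin]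
    with z h1 h2 hz
  refine lt_of_le_of_lt ?_ h1
  rw [dist_eq_norm]
  nth_rewrite 1 [← poisson_const (g ζ₀) hz]
  have hi := integrable_of_continuous hg
  rw [← poisson_sub hi (integrable_const _) hz]
  refine (norm_poisson_le _ hz).trans ?_
  -- Within `δ` of `ζ₀` the oscillation of `g` is below `ε / 2`. Elsewhere `‖ζ - z‖ ≥ δ / 2`, so the
  -- kernel is at most `(1 - ‖z‖²) / (δ / 2)²`, which vanishes at the boundary.
  have hgoal : ∀ ζ, kernel z ζ • ‖g ζ - g ζ₀‖ ≤
      kernel z ζ * (ε / 2) + (1 - ‖z‖ ^ 2) / (δ / 2) ^ 2 * B := by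
    intro ζ
    have hk := (kernel_pos hz ζ).le
    have hs := one_sub_norm_sq_pos hz
    rw [smul_eq_mul]
    by_cases hζ : dist ζ ζ₀ < δ
    · have h3 := hδg ζ hζ
      rw [dist_eq_norm] at h3
      have h4 := mul_le_mul_of_nonneg_left h3.le hk
      have : 0 ≤ (1 - ‖z‖ ^ 2) / (δ / 2) ^ 2 * B := by positivity
      linarith
    · have h3 : δ / 2 ≤ ‖(ζ : ℂ) - z‖ := by
        rw [← dist_eq_norm]
        have h4 := dist_triangle (ζ : ℂ) z ζ₀
        have h5 : dist ζ ζ₀ = dist (ζ : ℂ) (ζ₀ : ℂ) := rfl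
        push Not at hζ
        linarith
      have h4 := mul_le_mul (kernel_le hz ζ (by positivity) h3) (hB ζ) (norm_nonneg _)
        (by positivity)
      have : 0 ≤ kernel z ζ * (ε / 2) := by positivity
      linarith
  have hki : Integrable (kernel z) arc := integrable_of_continuous (continuous_kernel hz)
  rw [poisson_eq]
  refine (integral_mono (integrable_kernel_smul (hi.sub (integrable_const _)).norm hz)
    ((hki.mul_const _).add (integrable_const _)) hgoal).trans_eq ?_
  simp only [Pi.add_apply]
  rw [integral_add (hki.mul_const _) (integrable_const _), integral_mul_const, integral_kernel hz]
  simp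

open scoped ComplexConjugate

/-! ### Multiplicativity of the Poisson integral on `H^∞` -/

lemma isOpen_disk : IsOpen disk := isOpen_ball

lemma isConnected_disk : IsConnected disk :=
  ⟨⟨0, by simp [disk]⟩, (convex_ball (0 : ℂ) 1).isPreconnected⟩

/-- The Herglotz integral of a function on the circle. -/
def herglotz (f : Circle → ℂ) (w : ℂ) : ℂ :=
  ∫ ζ : Circle, (((ζ : ℂ) + w) / (ζ - w)) * f ζ ∂arc

lemma coe_sub_ne_zero {z : ℂ} (hz : z ∈ disk) (ζ : Circle) : (ζ : ℂ) - z ≠ 0 :=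
  norm_pos_iff.1 (norm_coe_sub_pos hz ζ)

lemma continuous_herglotz_kernel {w : ℂ} (hw : w ∈ disk) :
    Continuous fun ζ : Circle => ((ζ : ℂ) + w) / (ζ - w) :=
  Continuous.div (by fun_prop) (by fun_prop) (coe_sub_ne_zero hw)

lemma integrable_continuous_mul {k f : Circle → ℂ} (hk : Continuous k) (hf : Integrable f arc) :
    Integrable (fun ζ => k ζ * f ζ) arc := by
  obtain ⟨B, hB⟩ := isCompact_univ.exists_bound_of_continuousOn hk.continuousOn
  exact hf.bdd_mul hk.aestronglyMeasurable (ae_of_all _ fun ζ => hB ζ trivial)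

lemma analyticOnNhd_herglotz {f : Circle → ℂ} (hf : Integrable f arc) :
    AnalyticOnNhd ℂ (herglotz f) disk := by
  refine (analyticOnNhd_circleAverage_herglotzRieszKernel_smul
    (circleIntegrable_extendZero hf)).congr isOpen_disk fun w hw => ?_
  rw [herglotz, integral_arc (integrable_continuous_mul
    (continuous_herglotz_kernel hw) hf).aestronglyMeasurable, Real.circleAverage,
    Real.circleAverage]
  congr 2
  ext t
  simp only [extendZero_circleMap]
  simp [herglotzRieszKernel, circleMap, Circle.coe_exp]

lemma kernel_mul_sub {z : ℂ} (hz : z ∈ disk) (ζ : Circle) :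
    (kernel z ζ : ℂ) * (ζ - z) = ((1 - ‖z‖ ^ 2 : ℝ) : ℂ) / conj ((ζ : ℂ) - z) := by
  have h := coe_sub_ne_zero hz ζ
  have h' : conj ((ζ : ℂ) - z) ≠ 0 := (map_ne_zero _).2 h
  have h2 : (((‖(ζ : ℂ) - z‖ ^ 2 : ℝ)) : ℂ) = ((ζ : ℂ) - z) * conj ((ζ : ℂ) - z) := by
    rw [Complex.mul_conj, Complex.normSq_eq_norm_sq]
  rw [kernel, Complex.ofReal_div, h2]
  field_simp

lemma two_mul_kernel (z : ℂ) (ζ : Circle) :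
    2 * (kernel z ζ : ℂ) = ((ζ : ℂ) + z) / (ζ - z) + conj (((ζ : ℂ) + z) / (ζ - z)) := by
  have h := congrFun (poissonKernel_eq_re_herglotzRieszKernel (c := 0) (w := z)) (ζ : ℂ)
  simp only [poissonKernel, sub_zero, Circle.norm_coe, one_pow, Function.comp_apply,
    herglotzRieszKernel] at h
  rw [Complex.add_conj, ← h, kernel]
  push_cast
  rfl

lemma two_mul_poisson {f : Circle → ℂ} (hf : Integrable f arc) {z : ℂ} (hz : z ∈ disk) :
    2 * poisson f z = herglotz f z + conj (herglotz (fun ζ => conj (f ζ)) z) := by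
  have hk := continuous_herglotz_kernel hz
  rw [herglotz, herglotz, ← integral_conj, ← integral_add (integrable_continuous_mul hk hf)]
  · rw [poisson_eq, ← integral_const_mul]
    congr 1
    ext ζ
    rw [Complex.real_smul, ← mul_assoc, two_mul_kernel z ζ]
    simp only [map_mul, Complex.conj_conj]
    ring
  · simp only [map_mul, Complex.conj_conj]
    exact integrable_continuous_mul (Complex.continuous_conj.comp hk) hf

/-- If the Poisson integral of `f` is analytic, its antianalytic part is constant. -/
lemma herglotz_conj_eq {f : Circle → ℂ} (hf : Integrable f arc)
    (ha : AnalyticOnNhd ℂ (poisson f) disk) {z : ℂ} (hz : z ∈ disk) :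
    herglotz (fun ζ => conj (f ζ)) z = ∫ ζ, conj (f ζ) ∂arc := by
  have hf' : Integrable (fun ζ => conj (f ζ)) arc :=
    (Complex.conjCLE : ℂ →L[ℝ] ℂ).integrable_comp hf
  set G := herglotz fun ζ => conj (f ζ) with hG
  have hGa : AnalyticOnNhd ℂ G disk := analyticOnNhd_herglotz hf'
  -- The bracket equals `conj G`, so the sum is both analytic and real-valued, hence constant; then
  -- `Re G` and therefore `G` are constant, and `G 0` gives the value.
  have hS : AnalyticOnNhd ℂ (fun w => G w + (2 * poisson f w - herglotz f w)) disk :=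
    hGa.add ((analyticOnNhd_const.mul ha).sub (analyticOnNhd_herglotz hf))
  have hSG : ∀ w ∈ disk, G w + (2 * poisson f w - herglotz f w) = ((2 * (G w).re : ℝ) : ℂ) := by
    intro w hw
    rw [two_mul_poisson hf hw, add_sub_cancel_left, ← hG, Complex.add_conj]
  obtain ⟨c, hc⟩ := hS.eq_const_of_im_eq_const (c₀ := 0)
    (fun w hw => by simp only [hSG w hw, Complex.ofReal_im]) isOpen_disk isConnected_disk
  obtain ⟨d, hd⟩ := hGa.eq_const_of_re_eq_const (c₀ := c.re / 2) (fun w hw => by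
    have h := hc w hw
    rw [hSG w hw] at h
    rw [← h, Complex.ofReal_re]
    ring) isOpen_disk isConnected_disk
  have h0 : (0 : ℂ) ∈ disk := by simp [disk]
  rw [hd z hz, ← hd 0 h0, hG, herglotz]
  congr 1
  ext ζ
  simp

/-- The kernel times `ζ - z` is `(1 - ‖z‖²) / conj (ζ - z)`, while the Herglotz kernel minus `1` is
`2z / (ζ - z)`. So `2 conj z` times the difference of the two sides is a multiple of the conjugate
of an integral that vanishes by `herglotz_conj_eq`. -/
lemma poisson_coe_mul {f : Circle → ℂ} (hf : Integrable f arc)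
    (ha : AnalyticOnNhd ℂ (poisson f) disk) {z : ℂ} (hz : z ∈ disk) :
    poisson (fun ζ => (ζ : ℂ) * f ζ) z = z * poisson f z := by
  have hζf : Integrable (fun ζ : Circle => (ζ : ℂ) * f ζ) arc :=
    integrable_continuous_mul (by fun_prop) hf
  have hf' : Integrable (fun ζ => conj (f ζ)) arc :=
    (Complex.conjCLE : ℂ →L[ℝ] ℂ).integrable_comp hf
  have key : ∀ w ∈ disk, w ≠ 0 →
      poisson (fun ζ => (ζ : ℂ) * f ζ) w - w * poisson f w = 0 := by
    intro w hw hw0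
    have h1 : ∫ ζ : Circle, (((ζ : ℂ) + w) / (ζ - w)) * conj (f ζ) - conj (f ζ) ∂arc = 0 := by
      rw [integral_sub (integrable_continuous_mul (continuous_herglotz_kernel hw) hf') hf',
        ← herglotz_conj_eq hf ha hw, herglotz, sub_self]
    have h2 : 2 * conj w * (poisson (fun ζ => (ζ : ℂ) * f ζ) w - w * poisson f w) =
        ((1 - ‖w‖ ^ 2 : ℝ) : ℂ) *
          conj (∫ ζ : Circle, (((ζ : ℂ) + w) / (ζ - w)) * conj (f ζ) - conj (f ζ) ∂arc) := by
      rw [← integral_conj, ← integral_const_mul, poisson_eq, poisson_eq, ← integral_const_mul,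
        ← integral_sub (integrable_kernel_smul hζf hw) ((integrable_kernel_smul hf hw).const_mul _),
        ← integral_const_mul]
      congr 1
      ext ζ
      have h := coe_sub_ne_zero hw ζ
      have h' : conj (ζ : ℂ) - conj w ≠ 0 := by
        rw [← map_sub]
        exact (map_ne_zero _).2 h
      have hk := kernel_mul_sub hw ζ
      rw [Complex.real_smul, Complex.real_smul]
      calc 2 * conj w * ((kernel w ζ : ℂ) * (ζ * f ζ) - w * ((kernel w ζ : ℂ) * f ζ))
          = 2 * conj w * ((kernel w ζ : ℂ) * (ζ - w)) * f ζ := by ring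
        _ = _ := by
          rw [hk]
          simp only [map_sub, map_mul, map_div₀, map_add, Complex.conj_conj]
          field_simp
          ring
    rw [h1, map_zero, mul_zero] at h2
    refine (mul_eq_zero.1 h2).resolve_left (mul_ne_zero two_ne_zero ?_)
    exact (map_ne_zero _).2 hw0
  rw [← sub_eq_zero]
  -- The factor `conj w` cannot be cancelled at the origin, which is reached by continuity.
  rcases ne_or_eq z 0 with h0 | rfl
  · exact key z hz h0
  have hc : ContinuousAt (fun w => poisson (fun ζ => (ζ : ℂ) * f ζ) w - w * poisson f w) 0 := by
    have hn : disk ∈ 𝓝 (0 : ℂ) := isOpen_disk.mem_nhds hz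
    exact ((continuousOn_poisson hζf).continuousAt hn).sub
      (continuousAt_id.mul ((continuousOn_poisson hf).continuousAt hn))
  refine tendsto_nhds_unique (hc.tendsto.mono_left (nhdsWithin_le_nhds (s := {0}ᶜ))) ?_
  refine tendsto_const_nhds.congr' ?_
  filter_upwards [self_mem_nhdsWithin, mem_nhdsWithin_of_mem_nhds (isOpen_disk.mem_nhds hz)]
    with w hw0 hw
  exact (key w hw hw0).symm

/-- Each step preserves the hypothesis: the Poisson integral of `ζ ^ n * f` is `z ^ n * poisson f
z`, again analytic. -/
lemma poisson_pow_mul {f : Circle → ℂ} (hf : Integrable f arc)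
    (ha : AnalyticOnNhd ℂ (poisson f) disk) (n : ℕ) :
    ∀ z ∈ disk, poisson (fun ζ => (ζ : ℂ) ^ n * f ζ) z = z ^ n * poisson f z := by
  induction n with
  | zero => simp
  | succ n ih =>
    intro z hz
    have hn : AnalyticOnNhd ℂ (poisson fun ζ => (ζ : ℂ) ^ n * f ζ) disk :=
      ((analyticOnNhd_id.pow n).mul ha).congr isOpen_disk fun w hw => (ih w hw).symm
    have h := poisson_coe_mul (integrable_continuous_mul (by fun_prop) hf) hn hz
    rw [ih z hz, ← mul_assoc, ← pow_succ'] at h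
    rw [← h]
    simp only [pow_succ', mul_assoc]

lemma poisson_powerSeries_mul {f : Circle → ℂ} (hf : Integrable f arc)
    (ha : AnalyticOnNhd ℂ (poisson f) disk) {a : ℕ → ℂ} (hs : Summable fun n => ‖a n‖) {z : ℂ}
    (hz : z ∈ disk) :
    poisson (fun ζ => (∑' n, a n * (ζ : ℂ) ^ n) * f ζ) z = (∑' n, a n * z ^ n) * poisson f z := by
  have hi : ∀ n, Integrable (fun ζ => kernel z ζ • ((ζ : ℂ) ^ n * f ζ)) arc := fun n =>
    integrable_kernel_smul (integrable_continuous_mul (by fun_prop) hf) hz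
  have h := hasSum_integral_of_summable_integral_norm (μ := arc)
    (F := fun n ζ => a n * (kernel z ζ • ((ζ : ℂ) ^ n * f ζ))) (fun n => (hi n).const_mul _) (by
      simp only [norm_mul, norm_smul, norm_pow, Circle.norm_coe, one_pow, one_mul]
      simp only [integral_const_mul]
      exact hs.mul_right _)
  have h1 : ∀ n, ∫ ζ, a n * (kernel z ζ • ((ζ : ℂ) ^ n * f ζ)) ∂arc =
      a n * z ^ n * poisson f z := by
    intro n
    rw [integral_const_mul, ← poisson_eq, poisson_pow_mul hf ha n z hz, mul_assoc]
  simp only [h1] at h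
  rw [← tsum_mul_right, h.tsum_eq, poisson_eq]
  congr 1
  ext ζ
  rw [← tsum_mul_right, Complex.real_smul, ← tsum_mul_left]
  congr 1
  ext n
  rw [Complex.real_smul]
  ring

lemma poisson_dilation_mul {f : Circle → ℂ} (hf : Integrable f arc)
    (ha : AnalyticOnNhd ℂ (poisson f) disk) {g : ℂ → ℂ} (hg : AnalyticOnNhd ℂ g disk) {r : ℝ}
    (hr0 : 0 < r) (hr1 : r < 1) {z : ℂ} (hz : z ∈ disk) :
    poisson (fun ζ => g (r * ζ) * f ζ) z = g (r * z) * poisson f z := by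
  -- With `r < s < 1`, the Taylor series of `g` has radius at least `s`, so the coefficients of `g
  -- (r * ·)` are absolutely summable.
  obtain ⟨s, hrs, hs1⟩ := exists_between hr1
  lift s to NNReal using (hr0.trans hrs).le
  have hd : DifferentiableOn ℂ g (closedBall 0 s) :=
    hg.differentiableOn.mono fun w hw => by
      rw [disk, mem_ball_zero_iff]
      exact (mem_closedBall_zero_iff.1 hw).trans_lt hs1
  have hp := hd.hasFPowerSeriesOnBall (by exact_mod_cast hr0.trans hrs)
  set p := cauchyPowerSeries g 0 s
  have hmem : ∀ w : ℂ, ‖w‖ ≤ 1 → (r * w : ℂ) ∈ eball (0 : ℂ) s := by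
    intro w hw
    rw [Metric.eball_coe, mem_ball_zero_iff, norm_mul, Complex.norm_real,
      Real.norm_of_nonneg hr0.le]
    nlinarith
  have hsum : ∀ w : ℂ, ‖w‖ ≤ 1 → ∑' n, (p.coeff n * r ^ n) * w ^ n = g (r * w) := by
    intro w hw
    have h := (hp.hasSum (hmem w hw)).tsum_eq
    rw [zero_add] at h
    rw [← h]
    congr 1
    ext n
    rw [FormalMultilinearSeries.apply_eq_pow_smul_coeff, smul_eq_mul, mul_pow]
    ring
  have hsm : Summable fun n => ‖p.coeff n * (r : ℂ) ^ n‖ := by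
    have h := p.summable_norm_apply (x := (r : ℂ))
      (Metric.eball_subset_eball hp.r_le (by simpa using hmem 1 (by simp)))
    simpa only [FormalMultilinearSeries.apply_eq_pow_smul_coeff, smul_eq_mul, mul_comm] using h
  have h := poisson_powerSeries_mul hf ha hsm hz
  rw [hsum z (mem_ball_zero_iff.1 hz).le] at h
  rw [← h]
  congr 1
  ext ζ
  rw [hsum ζ ζ.norm_coe.le]

/-- The Poisson integral is multiplicative on products of a function in `H^∞` and one in the disk
algebra. -/
theorem poisson_mul {f F : Circle → ℂ} (hf : MemHInfty f) (hF : MemDiskAlgebra F) {z : ℂ}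
    (hz : z ∈ disk) : poisson (fun ζ => f ζ * F ζ) z = poisson f z * poisson F z := by
  have hfi : Integrable f arc := hf.1.integrable le_top
  obtain ⟨B, hB⟩ := isCompact_univ.exists_bound_of_continuousOn hF.2.continuousOn
  have hP : ∀ w ∈ disk, ‖poisson F w‖ ≤ B := fun w hw =>
    (norm_poisson_le F hw).trans
      (poisson_le_of_le (integrable_of_continuous hF.2.norm) (fun ζ => hB ζ trivial) hw)
  have hev : ∀ᶠ r : ℝ in 𝓝[<] 1, r ∈ Ioo (0 : ℝ) 1 := Ioo_mem_nhdsLT one_pos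
  have hdisk : ∀ r ∈ Ioo (0 : ℝ) 1, ∀ w : ℂ, ‖w‖ ≤ 1 → (r * w : ℂ) ∈ disk := by
    intro r hr w hw
    rw [disk, mem_ball_zero_iff, norm_mul, Complex.norm_real, Real.norm_of_nonneg hr.1.le]
    nlinarith [hr.1, hr.2]
  have hlim : ∀ w : ℂ, Tendsto (fun r : ℝ => (r * w : ℂ)) (𝓝[<] 1) (𝓝 w) := by
    intro w
    have : Continuous fun r : ℝ => (r * w : ℂ) := by fun_prop
    simpa using (this.tendsto 1).mono_left nhdsWithin_le_nhds
  -- Dominated convergence: the dilations of `F` are bounded by `B` and converge on the circle to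
  -- its continuous boundary values.
  have h1 : Tendsto (fun r : ℝ => poisson (fun ζ => poisson F (r * ζ) * f ζ) z) (𝓝[<] 1)
      (𝓝 (poisson (fun ζ => F ζ * f ζ) z)) := by
    refine tendsto_integral_filter_of_dominated_convergence
      (fun ζ => B * ‖kernel z ζ • f ζ‖) ?_ ?_
      ((integrable_kernel_smul hfi hz).norm.const_mul B) ?_
    · filter_upwards [hev] with r hr
      refine (integrable_kernel_smul (integrable_continuous_mul ?_ hfi) hz).aestronglyMeasurable
      exact hF.1.2.continuousOn.comp_continuous (by fun_prop) fun ζ => hdisk r hr ζ ζ.norm_coe.le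
    · filter_upwards [hev] with r hr
      refine ae_of_all _ fun ζ => ?_
      have h := hP _ (hdisk r hr ζ ζ.norm_coe.le)
      have h' : ‖kernel z ζ • (poisson F (r * ζ) * f ζ)‖ =
          ‖poisson F (r * ζ)‖ * ‖kernel z ζ • f ζ‖ := by
        simp only [norm_smul, norm_mul]
        ring
      exact h'.trans_le (mul_le_mul_of_nonneg_right h (norm_nonneg _))
    · refine ae_of_all _ fun ζ => ?_
      refine Tendsto.const_smul (Tendsto.mul_const _ ?_) _
      refine (tendsto_poisson_boundary hF.2 ζ).comp
        (tendsto_nhdsWithin_of_tendsto_nhds_of_eventually_within _ (hlim ζ) ?_)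
      filter_upwards [hev] with r hr using hdisk r hr ζ ζ.norm_coe.le
  have h2 : Tendsto (fun r : ℝ => poisson F (r * z) * poisson f z) (𝓝[<] 1)
      (𝓝 (poisson F z * poisson f z)) :=
    (((hF.1.2 z hz).continuousAt.tendsto.comp (hlim z)).mul_const _)
  have h3 := tendsto_nhds_unique h1 (h2.congr' (by
    filter_upwards [hev] with r hr
    exact (poisson_dilation_mul hfi hf.2 hF.1.2 hr.1 hr.2 hz).symm))
  simpa only [mul_comm] using h3

/-! ### Extremality of products -/

/-- The set where `‖F‖` is at most its essential supremum is closed and of full measure, hence the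
whole circle, so it contains the maximum point. -/
lemma eLpNorm_top_eq_of_continuous {F : Circle → ℂ} (hF : Continuous F) {M : ℝ}
    (h : ∀ ζ, ‖F ζ‖ ≤ M) {ζ₁ : Circle} (h₁ : ‖F ζ₁‖ = M) :
    eLpNorm F ∞ arc = ENNReal.ofReal M := by
  rw [eLpNorm_exponent_top]
  refine le_antisymm (eLpNormEssSup_le_of_ae_bound (ae_of_all _ h)) ?_
  have hc : IsClosed {ζ | ‖F ζ‖ₑ ≤ eLpNormEssSup F arc} := isClosed_le hF.enorm continuous_const
  have hu := hc.ae_eq_univ_iff_eq.1 (eventuallyEq_univ.2 (ae_le_eLpNormEssSup (μ := arc) (f := F)))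
  have h2 : ζ₁ ∈ {ζ | ‖F ζ‖ₑ ≤ eLpNormEssSup F arc} := hu ▸ mem_univ ζ₁
  rw [← h₁, ofReal_norm]
  exact h2

lemma nhdsWithin_disk_neBot {z : ℂ} (hz : z ∈ closedBall (0 : ℂ) 1) : (𝓝[disk] z).NeBot := by
  rw [← mem_closure_iff_nhdsWithin_neBot, disk, closure_ball 0 one_ne_zero]
  exact hz

lemma closedDiskFun_coe (F : Circle → ℂ) (ζ : Circle) : closedDiskFun F ζ = F ζ :=
  dif_pos ζ.norm_coe

lemma closedDiskFun_of_mem_disk (F : Circle → ℂ) {z : ℂ} (hz : z ∈ disk) :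
    closedDiskFun F z = poisson F z :=
  dif_neg (mem_ball_zero_iff.1 hz).ne

lemma mem_disk_or_eq_coe {z : ℂ} (hz : z ∈ closedBall (0 : ℂ) 1) :
    z ∈ disk ∨ ∃ ζ : Circle, (ζ : ℂ) = z := by
  rcases (mem_closedBall_zero_iff.1 hz).lt_or_eq with h | h
  · exact Or.inl (mem_ball_zero_iff.2 h)
  · exact Or.inr ⟨⟨z, mem_sphere_zero_iff_norm.2 h⟩, rfl⟩

lemma tendsto_poisson_of_mem_disk {E : Type*} [NormedAddCommGroup E] [NormedSpace ℝ E]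
    {g : Circle → E} (hg : Continuous g) {z : ℂ} (hz : z ∈ disk) :
    Tendsto (poisson g) (𝓝[disk] z) (𝓝 (poisson g z)) :=
  continuousOn_poisson (integrable_of_continuous hg) z hz

lemma tendsto_poisson_closedDiskFun {F : Circle → ℂ} (hF : Continuous F) {z : ℂ}
    (hz : z ∈ closedBall (0 : ℂ) 1) :
    Tendsto (poisson F) (𝓝[disk] z) (𝓝 (closedDiskFun F z)) := by
  rcases mem_disk_or_eq_coe hz with h | ⟨ζ, rfl⟩
  · rw [closedDiskFun_of_mem_disk F h]
    exact tendsto_poisson_of_mem_disk hF h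
  · rw [closedDiskFun_coe]
    exact tendsto_poisson_boundary hF ζ

/-- A zero-free function in the disk algebra whose modulus is constant on the circle has the same
constant modulus in the disk. -/
lemma norm_poisson_eq_of_norm_eq {F : Circle → ℂ} (hF : MemDiskAlgebra F)
    (h0 : ∀ z ∈ disk, poisson F z ≠ 0) {M : ℝ} (hM : ∀ ζ, ‖F ζ‖ = M) {z : ℂ} (hz : z ∈ disk) :
    ‖poisson F z‖ = M := by
  have hle : ‖poisson F z‖ ≤ M := (norm_poisson_le F hz).trans
    (poisson_le_of_le (integrable_of_continuous hF.2.norm) (fun ζ => (hM ζ).le) hz)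
  have hpos : 0 < M := (norm_pos_iff.2 (h0 z hz)).trans_le hle
  refine hle.antisymm ?_
  have hne : ∀ w ∈ closedBall (0 : ℂ) 1, closedDiskFun F w ≠ 0 := by
    intro w hw
    rcases mem_disk_or_eq_coe hw with h | ⟨ζ, rfl⟩
    · rw [closedDiskFun_of_mem_disk F h]
      exact h0 w h
    · rw [closedDiskFun_coe, ← norm_pos_iff, hM ζ]
      exact hpos
  have hlim : ∀ w ∈ closedBall (0 : ℂ) 1,
      Tendsto (fun w => (poisson F w)⁻¹) (𝓝[disk] w) (𝓝 (closedDiskFun F w)⁻¹) := fun w hw =>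
    (tendsto_poisson_closedDiskFun hF.2 hw).inv₀ (hne w hw)
  have hcl : closure disk = closedBall (0 : ℂ) 1 := closure_ball 0 one_ne_zero
  -- `1/F`, extended continuously to the closed disk, is bounded by `M⁻¹` on the circle; the maximum
  -- principle gives `‖F‖ ≥ M` inside.
  set G : ℂ → ℂ := extendFrom disk fun w => (poisson F w)⁻¹
  have hG : ∀ w ∈ closedBall (0 : ℂ) 1, G w = (closedDiskFun F w)⁻¹ := fun w hw =>
    extendFrom_eq (hcl ▸ hw) (hlim w hw)
  have hGd : ∀ w ∈ disk, G w = (poisson F w)⁻¹ := fun w hw => by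
    rw [hG w (ball_subset_closedBall hw), closedDiskFun_of_mem_disk F hw]
  have hGc : DiffContOnCl ℂ G disk := by
    refine ⟨(hF.1.2.differentiableOn.inv h0).congr hGd, ?_⟩
    exact continuousOn_extendFrom subset_rfl fun w hw => ⟨_, hlim w (hcl ▸ hw)⟩
  have hfr : ∀ w ∈ frontier disk, ‖G w‖ ≤ M⁻¹ := by
    intro w hw
    rw [disk, frontier_ball 0 one_ne_zero] at hw
    obtain ⟨ζ, rfl⟩ : ∃ ζ : Circle, (ζ : ℂ) = w := ⟨⟨w, hw⟩, rfl⟩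
    rw [hG _ (sphere_subset_closedBall hw), closedDiskFun_coe, norm_inv, hM ζ]
  have h := Complex.norm_le_of_forall_mem_frontier_norm_le isBounded_ball hGc hfr
    (subset_closure hz)
  rw [hGd z hz, norm_inv] at h
  exact (inv_le_inv₀ (norm_pos_iff.2 (h0 z hz)) hpos).1 h

/-- A zero-free function of the disk algebra attains its maximum modulus `M` at a point of the
closed disk if and only if the Poisson integral of `|F|²` tends to `M²` there. -/
lemma tendsto_poisson_norm_sq_iff {F : Circle → ℂ} (hF : MemDiskAlgebra F)
    (h0 : ∀ z ∈ disk, poisson F z ≠ 0) {M : ℝ} (hM : ∀ ζ, ‖F ζ‖ ≤ M) {z : ℂ}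
    (hz : z ∈ closedBall (0 : ℂ) 1) :
    Tendsto (poisson fun ζ => ‖F ζ‖ ^ 2) (𝓝[disk] z) (𝓝 (M ^ 2)) ↔ ‖closedDiskFun F z‖ = M := by
  have hM0 : 0 ≤ M := (norm_nonneg _).trans (hM 1)
  have hc : Continuous fun ζ => ‖F ζ‖ ^ 2 := hF.2.norm.pow 2
  have := nhdsWithin_disk_neBot hz
  rcases mem_disk_or_eq_coe hz with h | ⟨ζ, rfl⟩
  · rw [closedDiskFun_of_mem_disk F h]
    have hU := tendsto_poisson_of_mem_disk hc h
    constructor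
    · intro hl
      have hsq := eq_of_poisson_ge hc (fun ζ => pow_le_pow_left₀ (norm_nonneg _) (hM ζ) 2) h
        (tendsto_nhds_unique hl hU).le
      exact norm_poisson_eq_of_norm_eq hF h0
        (fun ζ => (sq_eq_sq₀ (norm_nonneg _) hM0).1 (hsq ζ)) h
    · intro hl
      have hn := eq_of_poisson_ge hF.2.norm hM h (hl ▸ norm_poisson_le F h)
      simp only [hn] at hU ⊢
      rwa [poisson_const _ h] at hU
  · rw [closedDiskFun_coe]
    have hU := tendsto_poisson_boundary hc ζ
    constructor
    · intro hl
      exact (sq_eq_sq₀ (norm_nonneg _) hM0).1 (tendsto_nhds_unique hU hl)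
    · rintro rfl
      exact hU

lemma Phi_mul_inner {F I : Circle → ℂ} (hF : MemDiskAlgebra F) (hI : IsInner I) {z : ℂ}
    (hz : z ∈ disk) :
    Phi (fun ζ => I ζ * F ζ) z =
      poisson (fun ζ => ‖F ζ‖ ^ 2) z - (‖poisson I z‖ * ‖poisson F z‖) ^ 2 := by
  rw [Phi, poisson_mul hI.1 hF hz, norm_mul]
  congr 1
  refine integral_congr_ae ?_
  filter_upwards [hI.2] with ζ hζ
  rw [norm_mul, hζ, one_mul]

/-- Removes the square root and the extended nonnegative reals: given the upper bound, equality says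
that `Φ_f` comes arbitrarily close to `M ^ 2`. -/
lemma garsiaNorm_eq_iff {f : Circle → ℂ} {M : ℝ} (hM : 0 < M) (h : ∀ z ∈ disk, Phi f z ≤ M ^ 2) :
    garsiaNorm f = ENNReal.ofReal M ↔ ∀ a < M ^ 2, ∃ z ∈ disk, a < Phi f z := by
  have hle : garsiaNorm f ≤ ENNReal.ofReal M :=
    iSup₂_le fun z hz => ENNReal.ofReal_le_ofReal (Real.sqrt_le_iff.2 ⟨hM.le, h z hz⟩)
  constructor
  · intro heq a ha
    have hlt : ENNReal.ofReal (Real.sqrt a) < garsiaNorm f := by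
      rw [heq]
      -- Negative `a` is covered too: its `Real.sqrt` is `0 < M`.
      exact (ENNReal.ofReal_lt_ofReal_iff hM).2 ((Real.sqrt_lt' hM).2 ha)
    obtain ⟨z, hz⟩ := lt_iSup_iff.1 hlt
    obtain ⟨hzd, hz⟩ := lt_iSup_iff.1 hz
    exact ⟨z, hzd, lt_of_not_ge fun hge =>
      hz.not_ge (ENNReal.ofReal_le_ofReal (Real.sqrt_le_sqrt hge))⟩
  · intro ha
    refine hle.antisymm (le_of_forall_lt fun c hc => ?_)
    lift c to NNReal using (hc.trans_le le_top).ne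
    have hc' : (c : ℝ) < M := by
      have := ENNReal.toReal_lt_of_lt_ofReal hc
      simpa using this
    obtain ⟨z, hz, hlt⟩ := ha ((c : ℝ) ^ 2) (pow_lt_pow_left₀ hc' c.2 two_ne_zero)
    refine lt_of_lt_of_le ?_ (le_iSup₂ (f := fun z _ => ENNReal.ofReal (Real.sqrt (Phi f z))) z hz)
    rw [← ENNReal.ofReal_coe_nnreal]
    have hs : (c : ℝ) < Real.sqrt (Phi f z) := (Real.lt_sqrt c.2).2 hlt
    exact (ENNReal.ofReal_lt_ofReal_iff (c.2.trans_lt hs)).2 hs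

end GarsiaExtremal

end

/-! ### Proof of the corollary -/

open GarsiaExtremal in
theorem mainTheorem10 (F I : Circle → ℂ)
    (hF : GarsiaExtremal.MemDiskAlgebra F)
    (hFout : GarsiaExtremal.IsOuter (GarsiaExtremal.poisson F))
    (hI : GarsiaExtremal.IsInner I) :
    GarsiaExtremal.IsGExtremal (fun ζ => I ζ * F ζ) ↔
      (GarsiaExtremal.maxModulusSet F ∩ GarsiaExtremal.innerSpectrum I).Nonempty := by
  have h0 := hFout.2.1
  obtain ⟨ζ₁, -, hmax⟩ := isCompact_univ.exists_isMaxOn univ_nonempty hF.2.norm.continuousOn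
  obtain ⟨M, hM₁⟩ : ∃ M, ‖F ζ₁‖ = M := ⟨_, rfl⟩
  have hM : ∀ ζ, ‖F ζ‖ ≤ M := fun ζ => hM₁ ▸ hmax (mem_univ ζ)
  have hPM : ∀ z ∈ disk, ‖poisson F z‖ ≤ M := fun z hz => (norm_poisson_le F hz).trans
    (poisson_le_of_le (integrable_of_continuous hF.2.norm) hM hz)
  have hMpos : 0 < M := by
    have h : (0 : ℂ) ∈ disk := mem_ball_self one_pos
    exact (norm_pos_iff.2 (h0 0 h)).trans_le (hPM 0 h)
  have hFn := eLpNorm_top_eq_of_continuous hF.2 hM hM₁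
  have hIF : eLpNorm (fun ζ => I ζ * F ζ) ∞ arc = ENNReal.ofReal M := by
    rw [← hFn]
    refine eLpNorm_congr_norm_ae ?_
    filter_upwards [hI.2] with ζ hζ
    rw [norm_mul, hζ, one_mul]
  have hmem : MemLp (fun ζ => I ζ * F ζ) ∞ arc :=
    ⟨hI.1.1.1.mul hF.1.1.1, hIF ▸ ENNReal.ofReal_lt_top⟩
  have hU : ∀ z ∈ disk, poisson (fun ζ => ‖F ζ‖ ^ 2) z ≤ M ^ 2 := fun z hz =>
    poisson_le_of_le (integrable_of_continuous (hF.2.norm.pow 2))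
      (fun ζ => pow_le_pow_left₀ (norm_nonneg _) (hM ζ) 2) hz
  have hmm : ∀ z ∈ closedBall (0 : ℂ) 1, (z ∈ maxModulusSet F ↔
      Tendsto (poisson fun ζ => ‖F ζ‖ ^ 2) (𝓝[disk] z) (𝓝 (M ^ 2))) := by
    intro z hz
    rw [tendsto_poisson_norm_sq_iff hF h0 hM hz, maxModulusSet, mem_ofPred_eq, hFn,
      ← ofReal_norm, ENNReal.ofReal_eq_ofReal_iff (norm_nonneg _) hMpos.le]
    exact and_iff_right hz
  have hPhi : ∀ z ∈ disk, Phi (fun ζ => I ζ * F ζ) z ≤ M ^ 2 := by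
    intro z hz
    rw [Phi_mul_inner hF hI hz]
    linarith [hU z hz, sq_nonneg (‖poisson I z‖ * ‖poisson F z‖)]
  rw [IsGExtremal, hIF, and_iff_right hmem, garsiaNorm_eq_iff hMpos hPhi]
  constructor
  · intro hsup
    set Φ := Phi fun ζ => I ζ * F ζ with hΦ
    -- This filter plays the role of a maximizing sequence for `Φ` in the disk; it is proper because
    -- `Φ ≤ M ^ 2` and values above every `a < M ^ 2` occur.
    have hne : (comap Φ (𝓝 (M ^ 2)) ⊓ 𝓟 disk).NeBot := by
      rw [inf_principal_neBot_iff]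
      rintro s ⟨t, ht, hts⟩
      obtain ⟨a, ha, hat⟩ := exists_Ioc_subset_of_mem_nhds ht ⟨_, sub_one_lt (M ^ 2)⟩
      obtain ⟨z, hz, hza⟩ := hsup a ha
      exact ⟨z, hts (hat ⟨hza, hPhi z hz⟩), hz⟩
    obtain ⟨z, hz, hcl⟩ := (isCompact_closedBall (0 : ℂ) 1).exists_clusterPt
      (f := comap Φ (𝓝 (M ^ 2)) ⊓ 𝓟 disk)
      (inf_le_right.trans (principal_mono.2 ball_subset_closedBall))
    set l := 𝓝 z ⊓ (comap Φ (𝓝 (M ^ 2)) ⊓ 𝓟 disk)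
    have hlne : l.NeBot := hcl
    have hlz : l ≤ 𝓝[disk] z := inf_le_inf_left _ inf_le_right
    have hld : ∀ᶠ w in l, w ∈ disk := hlz self_mem_nhdsWithin
    have hlΦ : Tendsto Φ l (𝓝 (M ^ 2)) :=
      tendsto_comap.mono_left (inf_le_right.trans inf_le_left)
    -- Squeeze: `Φ ≤ 𝒫(|F|²) ≤ M²`.
    have hlU : Tendsto (poisson fun ζ => ‖F ζ‖ ^ 2) l (𝓝 (M ^ 2)) := by
      refine tendsto_of_tendsto_of_tendsto_of_le_of_le' hlΦ tendsto_const_nhds ?_ ?_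
      · filter_upwards [hld] with w hw
        rw [hΦ, Phi_mul_inner hF hI hw]
        linarith [sq_nonneg (‖poisson I w‖ * ‖poisson F w‖)]
      · filter_upwards [hld] with w hw using hU w hw
    -- A limit at `z` through the whole disk exists by continuity of `|F|²`; the finer filter `l`
    -- only identifies its value.
    have hUz : Tendsto (poisson fun ζ => ‖F ζ‖ ^ 2) (𝓝[disk] z) (𝓝 (M ^ 2)) := by
      obtain ⟨c, hc⟩ : ∃ c, Tendsto (poisson fun ζ => ‖F ζ‖ ^ 2) (𝓝[disk] z) (𝓝 c) := by
        rcases mem_disk_or_eq_coe hz with h | ⟨ζ, rfl⟩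
        · exact ⟨_, tendsto_poisson_of_mem_disk (hF.2.norm.pow 2) h⟩
        · exact ⟨_, tendsto_poisson_boundary (hF.2.norm.pow 2) ζ⟩
      rwa [← tendsto_nhds_unique (hc.mono_left hlz) hlU]
    refine ⟨z, (hmm z hz).2 hUz, hz, ?_⟩
    have hFz : ‖closedDiskFun F z‖ = M := (tendsto_poisson_norm_sq_iff hF h0 hM hz).1 hUz
    have hlF : Tendsto (fun w => ‖poisson F w‖ ^ 2) l (𝓝 (M ^ 2)) := by
      have h := ((tendsto_poisson_closedDiskFun hF.2 hz).mono_left hlz).norm.pow 2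
      rwa [hFz] at h
    have hlI : Tendsto (fun w => ‖poisson I w‖) l (𝓝 0) := by
      -- Here `|I|² = (𝒫(|F|²) - Φ) / |F|²`, whose numerator tends to `0` and denominator to `M² >
      -- 0`.
      have h := ((hlU.sub hlΦ).div hlF (by positivity)).sqrt
      rw [sub_self, zero_div, Real.sqrt_zero] at h
      refine h.congr' ?_
      filter_upwards [hld] with w hw
      have hw0 : ‖poisson F w‖ ≠ 0 := norm_ne_zero_iff.2 (h0 w hw)
      rw [Pi.div_apply, hΦ, Phi_mul_inner hF hI hw, sub_sub_cancel, mul_pow, mul_div_cancel_right₀ _ (pow_ne_zero 2 hw0),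
        Real.sqrt_sq (norm_nonneg _)]
    have hlI' : Tendsto (fun w => ‖poisson I w‖ₑ) l (𝓝 0) := by
      have h := ENNReal.tendsto_ofReal hlI
      simpa only [ofReal_norm, ENNReal.ofReal_zero] using h
    refine le_antisymm ?_ bot_le
    -- Refining the filter can only increase the lower limit, so the limit `0` along `l` suffices.
    exact (liminf_le_liminf_of_le hlz).trans_eq hlI'.liminf_eq
  · rintro ⟨z, hzM, hz, hzI⟩ a ha
    have hUz := (hmm z hz).1 hzM
    obtain ⟨b, hab, hb⟩ := exists_between ha
    -- At a point with `𝒫(|F|²) > b` and `|I| < ε`, this choice gives `Φ > b - (ε * M) ^ 2 > a`.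
    obtain ⟨ε, hε, hεb⟩ : ∃ ε > 0, (ε * M) ^ 2 < b - a := by
      have hc : Continuous fun ε : ℝ => (ε * M) ^ 2 := by fun_prop
      have h1 := hc.tendsto 0
      simp only [zero_mul, ne_eq, OfNat.ofNat_ne_zero, not_false_eq_true, zero_pow] at h1
      have h2 := (h1.mono_left (nhdsWithin_le_nhds (s := Ioi 0))).eventually_lt_const
        (sub_pos.2 hab)
      exact ((eventually_mem_nhdsWithin (a := (0 : ℝ)) (s := Ioi 0)).and h2).exists
    have hfreq : ∃ᶠ w in 𝓝[disk] z, ‖poisson I w‖ₑ < ENNReal.ofReal ε := by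
      refine frequently_lt_of_liminf_lt (by isBoundedDefault) ?_
      rw [hzI]
      exact ENNReal.ofReal_pos.2 hε
    obtain ⟨w, hwI, hwU, hw⟩ := (hfreq.and_eventually
      ((hUz.eventually_const_lt hb).and self_mem_nhdsWithin)).exists
    refine ⟨w, hw, ?_⟩
    rw [Phi_mul_inner hF hI hw]
    rw [← ofReal_norm, ENNReal.ofReal_lt_ofReal_iff hε] at hwI
    have h3 : (‖poisson I w‖ * ‖poisson F w‖) ^ 2 ≤ (ε * M) ^ 2 := by
      have := hPM w hw
      gcongr
    linarith
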